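/- Let $N\ge M\ge 2$ and $k,\ell\ge 2$ be integers, and write $[n]=\{1,\dots,n\}$. Let $(U_{m,i})_{m\ge 0,\,i\in[k]}$ be i.i.d. random variables uniformly distributed on $[N]$, put $\mathcal U_m=(U_{m,1},\dots,U_{m,k})^T$, and let $\mathbf X^{(N,k)}=(X_m)_{m\ge0}$ be the chain of $k\times2$ matrices $X_m=[\mathcal U_m,\mathcal U_{m+1}]$. A pattern in $\mathcal P_{M,k}$ is a $k\times2$ matrix $R=(r_{i,j})$ with entries in $[M]\cup\{0\}$ such that $r_{i,1}\in[M]$ for all $i\in[k]$ and exactly one of the entries $r_{1,2},\dots,r_{k,2}$ is nonzero; the row of that entry is denoted $h(R)$. We say that $R$ occurs at time $m$ if replacing by $0$ all entries of the second column of $X_m$ except the one in row $h(R)$ turns $X_m$ into $R$, and we let $T_R\in\{0,1,2,\dots\}\cup\{\infty\}$ be the first time at which $R$ occurs. For $R,S\in\mathcal P_{M,k}$ let $O_2(R,S)=1$ if $r_{h(R),2}=s_{h(R),1}$, and $O_2(R,S)=0$ otherwise. Let $R_1,\dots,R_\ell\in\mathcal P_{M,k}$ be no-tie patterns, i.e.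 $\mathbb P(T_{R_i}=T_{R_j})=0$ for all $i\ne j$, and suppose that $O_2(R_i,R_i)=0$ for every $i\in[\ell]$. Then $T_{R_1},\dots,T_{R_\ell}$ are identically distributed. Moreover, there are real numbers $v_1,\dots,v_\ell>0$ such that, for every $i\in[\ell]$, $$p_i:=\mathbb P\Big(\bigcap_{j\in[\ell]}\{T_{R_i}\le T_{R_j}\}\Big)=\frac{v_i}{\sum_{j\in[\ell]}v_j}$$ and $$1-\frac1{N^k}\sum_{j\in[\ell]}O_2(R_j,R_i)\;\le\; v_i\;\le\;1-\frac1{N^k}\Big(1-\frac{\ell-1}{N^k}\Big)\sum_{j\in[\ell]}O_2(R_j,R_i).$$ -/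

import Mathlib

open MeasureTheory ProbabilityTheory

/-- A `k × 2` pattern with entries in `[M] ∪ {0}`, `[M] = {1, …, M}`: the first column has entries
in `[M]` and exactly one entry of the second column is nonzero. Column `0` of the matrix is the
first column, column `1` the second one. -/
structure Pattern (M k : ℕ) where
  entry : Matrix (Fin k) (Fin 2) ℕ
  entry_le : ∀ i j, entry i j ≤ M
  first_pos : ∀ i, 1 ≤ entry i 0
  existsUnique_hump : ∃! i, entry i 1 ≠ 0

namespace Pattern

/-- The index of hump `h(Q)`: the row of the unique nonzero entry of the second column. -/
noncomputable def hump {M k : ℕ} (Q : Pattern M k) : Fin k := Q.existsUnique_hump.choose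

theorem entry_hump_ne_zero {M k : ℕ} (Q : Pattern M k) : Q.entry Q.hump 1 ≠ 0 :=
  Q.existsUnique_hump.choose_spec.1

theorem eq_hump {M k : ℕ} (Q : Pattern M k) {i : Fin k} (hi : Q.entry i 1 ≠ 0) : i = Q.hump :=
  Q.existsUnique_hump.choose_spec.2 i hi

/-- The second component `O₂(R, S)` of the overlap. -/
noncomputable def overlapTwo {M k : ℕ} (R S : Pattern M k) : ℕ :=
  if R.entry R.hump 1 = S.entry R.hump 0 then 1 else 0

end Pattern

/-- The projection `Π_h` on `k × 2` matrices: keep the first column and the `h`-th entry of the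
second column, replace the other entries of the second column by `0`. -/
def patternProj {k : ℕ} (h : Fin k) (S : Matrix (Fin k) (Fin 2) ℕ) : Matrix (Fin k) (Fin 2) ℕ :=
  fun i j => if j = 0 ∨ i = h then S i j else 0

/-- `S ▷ R`, i.e. `Π_{h(R)} (S) = R`. -/
def Occurs {M k : ℕ} (R : Pattern M k) (S : Matrix (Fin k) (Fin 2) ℕ) : Prop :=
  patternProj R.hump S = R.entry

/-- `X_m = [𝒰_m, 𝒰_{m+1}]`, the `k × 2` matrix with columns `𝒰_m = (U m 1, …, U m k)` and
`𝒰_{m+1}`. -/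
def twoColumnChain {Ω : Type*} {k : ℕ} (U : ℕ → Fin k → Ω → ℕ) (m : ℕ) (ω : Ω) :
    Matrix (Fin k) (Fin 2) ℕ :=
  fun i j => U (m + j.val) i ω

/-- The hitting time `T_R = inf {m ∈ ℕ₀ : X_m ▷ R}`, with value `⊤ = ∞` if there is no such `m`. -/
noncomputable def hitTime {Ω : Type*} {M k : ℕ} (U : ℕ → Fin k → Ω → ℕ) (R : Pattern M k)
    (ω : Ω) : ℕ∞ :=
  sInf ((fun m : ℕ => (m : ℕ∞)) '' {m : ℕ | Occurs R (twoColumnChain U m ω)})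

/-! Let `t n` be the probability that no pattern occurs before time `n`, and `b n i` the probability
that, in addition, `R i` occurs at time `n`. Put `e = N⁻ᵏ` and `q = N⁻⁽ᵏ⁺¹⁾`. An occurrence at `n +
1` uses only entries fresh after time `n`, so avoiding before `n` and seeing `R i` at `n + 1` has
probability `t n * q`. Splitting by what happens at time `n` gives `t n * q = b (n+1) i + ∑ j, O j i
* e * b n j` (`measureReal_avoidsBefore_mul`): consecutive occurrences share a single entry, which
leaves `k` free ones if it matches.

For one pattern without self-overlap the correction vanishes and the recurrence determines the law.
For the whole family, summing over `n` gives `p i + e * ∑ j, O j i * p j = c` with `c` independent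
of `i` (`sum_recurrence`). Then `v i = p i / c` solves `v = 1 - e Oᵀ v`; inserting `v ≤ 1` yields
the lower bound, and inserting that bound once more yields the upper one (`weight_bounds`). -/

section Array

/-! ### Independence and occurrence events. -/

variable {Ω : Type*} {N M k : ℕ}

/-- The entries `U m i` are i.i.d. and uniformly distributed on `{1, …, N}`. -/
structure IsUniformArray [MeasurableSpace Ω] (μ : Measure Ω) (N : ℕ) (U : ℕ → Fin k → Ω → ℕ) :
    Prop where
  measurable : ∀ m i, Measurable (U m i)
  map_eq : ∀ m i, μ.map (U m i) = uniformOn (Set.Icc 1 N)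
  iIndepFun : iIndepFun (fun p : ℕ × Fin k => U p.1 p.2) μ

/-- The event `A` is determined by the values of the entries with index in `S`. -/
def DeterminedBy (U : ℕ → Fin k → Ω → ℕ) (S : Finset (ℕ × Fin k)) (A : Set Ω) : Prop :=
  ∀ ω ω', (∀ p ∈ S, U p.1 p.2 ω = U p.1 p.2 ω') → ω ∈ A → ω' ∈ A

/-- Finitely many entries take values in a countable discrete space, so this form yields both
measurability and independence of such events. -/
theorem DeterminedBy.eq_preimage {U : ℕ → Fin k → Ω → ℕ} {S : Finset (ℕ × Fin k)} {A : Set Ω}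
    (hA : DeterminedBy U S A) :
    A = (fun ω (p : S) => U p.1.1 p.1.2 ω) ⁻¹' ((fun ω (p : S) => U p.1.1 p.1.2 ω) '' A) := by
  refine Set.Subset.antisymm (Set.subset_preimage_image _ _) ?_
  rintro ω' ⟨ω, hω, h⟩
  exact hA ω ω' (fun p hp => congrFun h ⟨p, hp⟩) hω

namespace IsUniformArray

variable [MeasurableSpace Ω] {μ : Measure Ω} {U : ℕ → Fin k → Ω → ℕ}

theorem measurableSet_of_determinedBy (hU : IsUniformArray μ N U) {S : Finset (ℕ × Fin k)}
    {A : Set Ω} (hA : DeterminedBy U S A) : MeasurableSet A := by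
  rw [hA.eq_preimage]
  exact measurable_pi_lambda _ (fun p : S => hU.measurable p.1.1 p.1.2)
    (Set.to_countable _).measurableSet

theorem measureReal_eq (hU : IsUniformArray μ N U) (m : ℕ) (i : Fin k) {a : ℕ}
    (ha : a ∈ Set.Icc 1 N) : μ.real {ω | U m i ω = a} = 1 / (N : ℝ) := by
  have h : μ {ω | U m i ω = a} = uniformOn (Set.Icc 1 N) {a} := by
    rw [← hU.map_eq m i, Measure.map_apply (hU.measurable m i) (measurableSet_singleton a)]
    rfl
  rw [measureReal_def, h, ← Finset.coe_Icc, ← Finset.coe_singleton, uniformOn_apply_finset,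
    Finset.inter_singleton_of_mem (by simpa using ha)]
  simp

theorem ae_mem_Icc (hU : IsUniformArray μ N U) :
    ∀ᵐ ω ∂μ, ∀ m i, U m i ω ∈ Set.Icc 1 N := by
  rw [ae_all_iff]; intro m
  rw [ae_all_iff]; intro i
  have h : ∀ᵐ x ∂(μ.map (U m i)), x ∈ Set.Icc 1 N := by
    rw [hU.map_eq, ae_iff]
    exact (uniformOn_eq_zero_iff (Set.finite_Icc 1 N)).2 (by ext; simp)
  exact ae_of_ae_map (hU.measurable m i).aemeasurable h

/-- Cylinders are independent of events determined by the remaining entries. -/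
theorem measureReal_inter_cylinder (hU : IsUniformArray μ N U) {S T : Finset (ℕ × Fin k)}
    (hST : Disjoint S T) {A : Set Ω} (hA : DeterminedBy U S A) {a : ℕ × Fin k → ℕ}
    (ha : ∀ p ∈ T, a p ∈ Set.Icc 1 N) :
    μ.real (A ∩ {ω | ∀ p ∈ T, U p.1 p.2 ω = a p}) = μ.real A * (1 / (N : ℝ)) ^ T.card := by
  have hB : DeterminedBy U T {ω | ∀ p ∈ T, U p.1 p.2 ω = a p} := fun ω ω' h hω p hp =>
    (h p hp).symm.trans (hω p hp)
  have hcyl : μ {ω | ∀ p ∈ T, U p.1 p.2 ω = a p} = ∏ p ∈ T, μ {ω | U p.1 p.2 ω = a p} := by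
    refine Eq.trans ?_ (hU.iIndepFun.measure_inter_preimage_eq_mul T (sets := fun p => {a p})
      (fun p _ => measurableSet_singleton _))
    congr 1
    ext ω; simp
  have hind := (hU.iIndepFun.indepFun_finset S T hST
    (fun p => hU.measurable p.1 p.2)).measure_inter_preimage_eq_mul
    ((fun ω (p : S) => U p.1.1 p.1.2 ω) '' A)
    ((fun ω (p : T) => U p.1.1 p.1.2 ω) '' {ω | ∀ p ∈ T, U p.1 p.2 ω = a p})
    (Set.to_countable _).measurableSet (Set.to_countable _).measurableSet
  rw [← hA.eq_preimage, ← hB.eq_preimage, hcyl] at hind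
  rw [measureReal_def, hind, ENNReal.toReal_mul, ENNReal.toReal_prod, ← measureReal_def]
  congr 1
  exact Finset.prod_eq_pow_card fun p hp => hU.measureReal_eq p.1 p.2 (ha p hp)

end IsUniformArray

/-- The event that the pattern `Q` occurs at time `n`. -/
def occursAt (U : ℕ → Fin k → Ω → ℕ) (Q : Pattern M k) (n : ℕ) : Set Ω :=
  {ω | Occurs Q (twoColumnChain U n ω)}

/-- The event that no pattern of the family `R` occurs before time `n`. -/
def avoidsBefore {ι : Type*} (U : ℕ → Fin k → Ω → ℕ) (R : ι → Pattern M k) (n : ℕ) : Set Ω :=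
  {ω | ∀ m < n, ∀ j, ω ∉ occursAt U (R j) m}

theorem mem_occursAt {U : ℕ → Fin k → Ω → ℕ} {Q : Pattern M k} {n : ℕ} {ω : Ω} :
    ω ∈ occursAt U Q n ↔
      (∀ x, U n x ω = Q.entry x 0) ∧ U (n + 1) Q.hump ω = Q.entry Q.hump 1 := by
  constructor
  · intro h
    have h' : patternProj Q.hump (twoColumnChain U n ω) = Q.entry := h
    refine ⟨fun x => ?_, ?_⟩
    · simpa [patternProj, twoColumnChain] using congrFun (congrFun h' x) 0
    · simpa [patternProj, twoColumnChain] using congrFun (congrFun h' Q.hump) 1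
  · rintro ⟨h0, h1⟩
    change patternProj Q.hump (twoColumnChain U n ω) = Q.entry
    ext x j
    fin_cases j
    · simpa [patternProj, twoColumnChain] using h0 x
    · by_cases hx : x = Q.hump
      · subst hx
        simpa [patternProj, twoColumnChain] using h1
      · have : Q.entry x 1 = 0 := by
          by_contra hne
          exact hx (Q.eq_hump hne)
        simp [patternProj, hx, this]

theorem Pattern.entry_zero_mem (Q : Pattern M k) (hN : M ≤ N) (x : Fin k) :
    Q.entry x 0 ∈ Set.Icc 1 N := ⟨Q.first_pos x, (Q.entry_le x 0).trans hN⟩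

theorem Pattern.entry_hump_mem (Q : Pattern M k) (hN : M ≤ N) :
    Q.entry Q.hump 1 ∈ Set.Icc 1 N :=
  ⟨Nat.one_le_iff_ne_zero.2 Q.entry_hump_ne_zero, (Q.entry_le _ _).trans hN⟩

theorem mem_avoidsBefore_succ {ι : Type*} {U : ℕ → Fin k → Ω → ℕ} {R : ι → Pattern M k} {n : ℕ}
    {ω : Ω} : ω ∈ avoidsBefore U R (n + 1) ↔
      ω ∈ avoidsBefore U R n ∧ ∀ j, ω ∉ occursAt U (R j) n := by
  simp only [avoidsBefore, Set.mem_ofPred_eq]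
  refine ⟨fun h => ⟨fun m hm => h m (by omega), h n (by omega)⟩, fun h m hm => ?_⟩
  rcases Nat.lt_succ_iff_lt_or_eq.1 hm with hm | rfl
  · exact h.1 m hm
  · exact h.2

/-- The entries with time index at most `n`. -/
def entriesUpTo (k n : ℕ) : Finset (ℕ × Fin k) := Finset.range (n + 1) ×ˢ Finset.univ

theorem mem_entriesUpTo {n : ℕ} {p : ℕ × Fin k} : p ∈ entriesUpTo k n ↔ p.1 ≤ n := by
  simp [entriesUpTo]

theorem determinedBy_avoidsBefore {ι : Type*} (U : ℕ → Fin k → Ω → ℕ) (R : ι → Pattern M k)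
    (n : ℕ) : DeterminedBy U (entriesUpTo k n) (avoidsBefore U R n) := by
  intro ω ω' h hω m hm j hj
  refine hω m hm j ?_
  rw [mem_occursAt] at hj ⊢
  refine ⟨fun x => (h (m, x) (mem_entriesUpTo.2 ?_)).trans (hj.1 x),
    (h (m + 1, _) (mem_entriesUpTo.2 ?_)).trans hj.2⟩
  · exact hm.le
  · exact hm

theorem determinedBy_avoidsBefore_inter_occursAt {ι : Type*} (U : ℕ → Fin k → Ω → ℕ)
    (R : ι → Pattern M k) (Q : Pattern M k) (n : ℕ) :
    DeterminedBy U (insert (n + 1, Q.hump) (entriesUpTo k n))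
      (avoidsBefore U R n ∩ occursAt U Q n) := by
  intro ω ω' h hω
  refine ⟨determinedBy_avoidsBefore U R n ω ω' (fun p hp => h p (Finset.mem_insert_of_mem hp)) hω.1,
    ?_⟩
  have h2 := mem_occursAt.1 hω.2
  refine mem_occursAt.2 ⟨fun x => ?_, ?_⟩
  · rw [← h2.1 x]
    exact (h (n, x) (Finset.mem_insert_of_mem (mem_entriesUpTo.2 le_rfl))).symm
  · rw [← h2.2]
    exact (h _ (Finset.mem_insert_self _ _)).symm

namespace IsUniformArray

variable [MeasurableSpace Ω] {μ : Measure Ω} {U : ℕ → Fin k → Ω → ℕ}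

theorem measurableSet_occursAt (hU : IsUniformArray μ N U) (Q : Pattern M k) (n : ℕ) :
    MeasurableSet (occursAt U Q n) := by
  -- The empty family makes the avoidance event trivial.
  have h := hU.measurableSet_of_determinedBy
    (determinedBy_avoidsBefore_inter_occursAt U (fun j : Empty => j.elim) Q n)
  rwa [show avoidsBefore U (fun j : Empty => (j.elim : Pattern M k)) n = Set.univ from
    Set.eq_univ_of_forall fun ω m _ j => j.elim, Set.univ_inter] at h

theorem measurableSet_avoidsBefore {ι : Type*} (hU : IsUniformArray μ N U) (R : ι → Pattern M k)
    (n : ℕ) : MeasurableSet (avoidsBefore U R n) :=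
  hU.measurableSet_of_determinedBy (determinedBy_avoidsBefore U R n)

/-- A fresh occurrence is independent of events determined by strictly earlier entries. -/
theorem measureReal_inter_occursAt (hU : IsUniformArray μ N U) (hN : M ≤ N) (Q : Pattern M k)
    {n : ℕ} {S : Finset (ℕ × Fin k)} (hS : ∀ p ∈ S, p.1 < n) {A : Set Ω}
    (hA : DeterminedBy U S A) :
    μ.real (A ∩ occursAt U Q n) = μ.real A * (1 / (N : ℝ)) ^ (k + 1) := by
  let T : Finset (ℕ × Fin k) := insert (n + 1, Q.hump) (Finset.univ.image fun x => (n, x))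
  let a : ℕ × Fin k → ℕ := fun p => if p.1 = n then Q.entry p.2 0 else Q.entry p.2 1
  have hT : T.card = k + 1 := by
    rw [Finset.card_insert_of_notMem (by simp), Finset.card_image_of_injective _
      (fun x y h => by simpa using h)]
    simp
  have hcyl : occursAt U Q n = {ω | ∀ p ∈ T, U p.1 p.2 ω = a p} := by
    ext ω
    simp [mem_occursAt, T, a, and_comm]
  rw [hcyl, hU.measureReal_inter_cylinder _ hA, hT]
  · simp only [T, a, Finset.mem_insert, Finset.mem_image, Finset.mem_univ, true_and]
    rintro p (rfl | ⟨x, rfl⟩)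
    · simpa using Q.entry_hump_mem hN
    · simpa using Q.entry_zero_mem hN x
  · rw [Finset.disjoint_left]
    intro p hp hpT
    have := hS p hp
    simp only [T, Finset.mem_insert, Finset.mem_image, Finset.mem_univ, true_and] at hpT
    rcases hpT with rfl | ⟨x, rfl⟩ <;> simp at this

/-- The occurrence of `P` at `n` has already fixed the entry `(n + 1, P.hump)`. `Q` either
contradicts it or requires only `k` further entries: `k - 1` at time `n + 1` and its hump at `n +
2`. -/
theorem measureReal_inter_occursAt_succ {ι : Type*} (hU : IsUniformArray μ N U) (hN : M ≤ N)
    (R : ι → Pattern M k) (P Q : Pattern M k) (n : ℕ) :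
    μ.real (avoidsBefore U R n ∩ occursAt U P n ∩ occursAt U Q (n + 1)) =
      P.overlapTwo Q * ((1 / (N : ℝ)) ^ k * μ.real (avoidsBefore U R n ∩ occursAt U P n)) := by
  by_cases hPQ : P.entry P.hump 1 = Q.entry P.hump 0
  swap
  · have hempty : avoidsBefore U R n ∩ occursAt U P n ∩ occursAt U Q (n + 1) = ∅ := by
      refine Set.eq_empty_of_forall_notMem fun ω hω => hPQ ?_
      rw [← (mem_occursAt.1 hω.1.2).2, (mem_occursAt.1 hω.2).1]
    simp [hempty, Pattern.overlapTwo, hPQ]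
  let T : Finset (ℕ × Fin k) :=
    insert (n + 2, Q.hump) ((Finset.univ.erase P.hump).image fun x => (n + 1, x))
  let a : ℕ × Fin k → ℕ := fun p => if p.1 = n + 1 then Q.entry p.2 0 else Q.entry p.2 1
  have hT : T.card = k := by
    rw [Finset.card_insert_of_notMem (by simp), Finset.card_image_of_injective _
      (fun x y h => by simpa using h), Finset.card_erase_of_mem (Finset.mem_univ _),
      Finset.card_univ, Fintype.card_fin]
    have := P.hump.pos
    omega
  have hcyl : avoidsBefore U R n ∩ occursAt U P n ∩ occursAt U Q (n + 1) =
      avoidsBefore U R n ∩ occursAt U P n ∩ {ω | ∀ p ∈ T, U p.1 p.2 ω = a p} := by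
    ext ω
    refine and_congr_right fun hω => ?_
    have hω2 := (mem_occursAt.1 hω.2).2
    rw [mem_occursAt]
    simp only [T, a, Set.mem_ofPred_eq, Finset.mem_insert, Finset.mem_image, Finset.mem_erase,
      Finset.mem_univ, and_true]
    constructor
    · rintro ⟨h0, h1⟩ p (rfl | ⟨x, -, rfl⟩)
      · simpa using h1
      · simpa using h0 x
    · intro h
      refine ⟨fun x => ?_, by simpa using h _ (Or.inl rfl)⟩
      by_cases hx : x = P.hump
      · rw [hx, hω2, hPQ]
      · simpa using h _ (Or.inr ⟨x, hx, rfl⟩)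
  rw [hcyl, hU.measureReal_inter_cylinder _ (determinedBy_avoidsBefore_inter_occursAt U R P n), hT]
  · simp [Pattern.overlapTwo, hPQ, mul_comm]
  · simp only [T, a, Finset.mem_insert, Finset.mem_image, Finset.mem_erase, Finset.mem_univ,
      and_true]
    rintro p (rfl | ⟨x, -, rfl⟩)
    · simpa using Q.entry_hump_mem hN
    · simpa using Q.entry_zero_mem hN x
  · rw [Finset.disjoint_left]
    intro p hp hpT
    simp only [T, Finset.mem_insert, Finset.mem_image, Finset.mem_erase, Finset.mem_univ,
      and_true] at hpT
    rw [Finset.mem_insert, mem_entriesUpTo] at hp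
    rcases hpT with rfl | ⟨x, hx, rfl⟩ <;> simp at hp
    exact hx hp

end IsUniformArray

end Array

/-! ### Hitting times in terms of occurrence events. -/

section HitTime

variable {Ω : Type*} {M k : ℕ} {U : ℕ → Fin k → Ω → ℕ} {Q : Pattern M k} {ω : Ω} {n : ℕ}

theorem hitTime_le (h : ω ∈ occursAt U Q n) : hitTime U Q ω ≤ n := sInf_le ⟨n, h, rfl⟩

theorem le_hitTime (h : ∀ m < n, ω ∉ occursAt U Q m) : (n : ℕ∞) ≤ hitTime U Q ω := by
  refine le_sInf ?_
  rintro _ ⟨m, hm, rfl⟩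
  simp only [Nat.cast_le]
  by_contra hlt
  exact h m (not_le.1 hlt) hm

theorem notMem_occursAt_of_lt (h : (n : ℕ∞) < hitTime U Q ω) : ω ∉ occursAt U Q n :=
  fun hn => (hitTime_le hn).not_gt h

theorem mem_occursAt_of_hitTime_eq (h : hitTime U Q ω = n) : ω ∈ occursAt U Q n := by
  have hne : ((fun m : ℕ => (m : ℕ∞)) ''
      {m : ℕ | Occurs Q (twoColumnChain U m ω)}).Nonempty := by
    by_contra hempty
    rw [hitTime, Set.not_nonempty_iff_eq_empty.1 hempty, sInf_empty] at h
    exact ENat.top_ne_natCast n h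
  obtain ⟨m, hm, hmn⟩ := csInf_mem hne
  rw [hitTime] at h
  rw [h, Nat.cast_inj] at hmn
  exact hmn ▸ hm

theorem hitTime_eq_natCast :
    hitTime U Q ω = n ↔ ω ∈ avoidsBefore U (fun _ : Unit => Q) n ∩ occursAt U Q n := by
  refine ⟨fun h => ⟨fun m hm _ => notMem_occursAt_of_lt ?_, mem_occursAt_of_hitTime_eq h⟩,
    fun h => le_antisymm (hitTime_le h.2) (le_hitTime fun m hm => h.1 m hm ())⟩
  rw [h]
  exact_mod_cast hm

end HitTime

/-! ### The recurrence and the common law. -/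

section Recurrence

variable {Ω : Type*} {N M k : ℕ} [MeasurableSpace Ω] {μ : Measure Ω} {U : ℕ → Fin k → Ω → ℕ}
  {ι : Type*} {R : ι → Pattern M k}

/-- Almost surely, no two patterns of the family occur simultaneously. -/
def NeverSimultaneous (μ : Measure Ω) (U : ℕ → Fin k → Ω → ℕ) (R : ι → Pattern M k) : Prop :=
  ∀ i j, i ≠ j → ∀ n, μ (occursAt U (R i) n ∩ occursAt U (R j) n) = 0

/-- If a joint occurrence at `n` had positive probability, moving the entries of one such sample to
time `0` would give a cylinder of positive probability on which both hitting times are `0`, a tie.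
-/
theorem IsUniformArray.neverSimultaneous [IsProbabilityMeasure μ] (hU : IsUniformArray μ N U)
    (h : ∀ i j, i ≠ j → μ {ω | hitTime U (R i) ω = hitTime U (R j) ω} = 0) :
    NeverSimultaneous μ U R := by
  intro i j hij n
  by_contra hpos
  obtain ⟨ω, ⟨hi, hj⟩, hω⟩ :=
    ((frequently_ae_mem_iff.2 hpos).and_eventually hU.ae_mem_Icc).exists
  let T : Finset (ℕ × Fin k) :=
    {(1, (R i).hump), (1, (R j).hump)} ∪ Finset.univ.image fun x => (0, x)
  have hcyl := hU.measureReal_inter_cylinder (S := ∅) (T := T) (A := Set.univ)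
    (Finset.disjoint_empty_left _) (fun _ _ _ h => h) (a := fun p => U (n + p.1) p.2 ω)
    (fun p _ => hω _ _)
  rw [Set.univ_inter] at hcyl
  have hzero : μ.real {ω' | ∀ p ∈ T, U p.1 p.2 ω' = U (n + p.1) p.2 ω} = 0 := by
    rw [measureReal_def, measure_mono_null ?_ (h i j hij), ENNReal.toReal_zero]
    intro ω' hω'
    have key : ∀ l, l = i ∨ l = j → ω ∈ occursAt U (R l) n → hitTime U (R l) ω' = 0 := by
      intro l hl hocc
      rw [mem_occursAt] at hocc
      refine le_antisymm (hitTime_le (n := 0) (mem_occursAt.2 ⟨fun x => ?_, ?_⟩)) bot_le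
      · rw [← hocc.1 x]
        exact hω' (0, x) (by simp [T])
      · rw [← hocc.2]
        exact hω' (1, (R l).hump) (by rcases hl with rfl | rfl <;> simp [T])
    change hitTime U (R i) ω' = hitTime U (R j) ω'
    rw [key i (Or.inl rfl) hi, key j (Or.inr rfl) hj]
  have hN : 0 < N := (hω 0 (R i).hump).1.trans (hω 0 (R i).hump).2
  rw [hzero] at hcyl
  have : (0 : ℝ) < μ.real Set.univ * (1 / (N : ℝ)) ^ T.card := by
    rw [probReal_univ]
    positivity
  exact this.ne hcyl

theorem IsUniformArray.measurable_hitTime (hU : IsUniformArray μ N U) (Q : Pattern M k) :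
    Measurable (hitTime U Q) := by
  refine ENat.measurable_iff.2 fun n => ?_
  rw [show hitTime U Q ⁻¹' {(n : ℕ∞)} =
    avoidsBefore U (fun _ : Unit => Q) n ∩ occursAt U Q n from
      Set.ext fun ω => hitTime_eq_natCast]
  exact (hU.measurableSet_avoidsBefore _ n).inter (hU.measurableSet_occursAt Q n)

variable [IsProbabilityMeasure μ]

/-- At time `n` either nothing occurs or, up to a null set, exactly one pattern does. -/
theorem IsUniformArray.measureReal_avoidsBefore_inter [Fintype ι] (hU : IsUniformArray μ N U)
    (hR : NeverSimultaneous μ U R) (n : ℕ) {A : Set Ω} (hA : MeasurableSet A) :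
    μ.real (avoidsBefore U R n ∩ A) = μ.real (avoidsBefore U R (n + 1) ∩ A) +
      ∑ j, μ.real (avoidsBefore U R n ∩ occursAt U (R j) n ∩ A) := by
  rw [← measureReal_biUnion_finset₀ (s := Finset.univ),
    ← measureReal_inter_add_sdiff (s := avoidsBefore U R n ∩ A)
      (hU.measurableSet_avoidsBefore R (n + 1))]
  · congr 2
    · ext ω
      simp only [Set.mem_inter_iff, mem_avoidsBefore_succ]
      tauto
    · ext ω
      simp only [Set.mem_sdiff, Set.mem_inter_iff, mem_avoidsBefore_succ, Set.mem_iUnion,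
        Finset.mem_univ, exists_prop, true_and]
      constructor
      · rintro ⟨⟨h1, h2⟩, h3⟩
        by_contra! hne
        exact h3 ⟨h1, fun j hj => hne j ⟨h1, hj⟩ h2⟩
      · rintro ⟨j, ⟨h1, hj⟩, h2⟩
        exact ⟨⟨h1, h2⟩, fun h => h.2 j hj⟩
  · intro i _ j _ hij
    exact measure_mono_null (t := occursAt U (R i) n ∩ occursAt U (R j) n)
      (fun ω hω => ⟨hω.1.1.2, hω.2.1.2⟩) (hR i j hij n)
  · exact fun j _ => (((hU.measurableSet_avoidsBefore R n).inter
      (hU.measurableSet_occursAt (R j) n)).inter hA).nullMeasurableSet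

theorem IsUniformArray.measureReal_occursAt_zero (hU : IsUniformArray μ N U) (hN : M ≤ N)
    (Q : Pattern M k) :
    μ.real (avoidsBefore U R 0 ∩ occursAt U Q 0) = (1 / (N : ℝ)) ^ (k + 1) := by
  have h : avoidsBefore U R 0 = Set.univ := Set.eq_univ_of_forall fun ω m hm => by omega
  rw [hU.measureReal_inter_occursAt hN Q (S := ∅) (by simp) (by rw [h]; exact fun _ _ _ h => h), h,
    probReal_univ, one_mul]

theorem IsUniformArray.measureReal_avoidsBefore_mul [Fintype ι] (hU : IsUniformArray μ N U)
    (hN : M ≤ N) (hR : NeverSimultaneous μ U R) (n : ℕ) (i : ι) :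
    μ.real (avoidsBefore U R n) * (1 / (N : ℝ)) ^ (k + 1) =
      μ.real (avoidsBefore U R (n + 1) ∩ occursAt U (R i) (n + 1)) +
      ∑ j, ((R j).overlapTwo (R i) : ℝ) * ((1 / (N : ℝ)) ^ k *
        μ.real (avoidsBefore U R n ∩ occursAt U (R j) n)) := by
  rw [← hU.measureReal_inter_occursAt hN (R i) (n := n + 1) (S := entriesUpTo k n)
    (fun p hp => Nat.lt_succ_of_le (mem_entriesUpTo.1 hp)) (determinedBy_avoidsBefore U R n),
    hU.measureReal_avoidsBefore_inter hR n (hU.measurableSet_occursAt _ _)]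
  simp_rw [hU.measureReal_inter_occursAt_succ hN]

theorem IsUniformArray.measureReal_avoidsBefore_eq [Fintype ι] (hU : IsUniformArray μ N U)
    (hR : NeverSimultaneous μ U R) (n : ℕ) :
    μ.real (avoidsBefore U R n) = μ.real (avoidsBefore U R (n + 1)) +
      ∑ j, μ.real (avoidsBefore U R n ∩ occursAt U (R j) n) := by
  simpa using hU.measureReal_avoidsBefore_inter hR n MeasurableSet.univ

theorem IsUniformArray.measureReal_avoidsBefore_congr (hU : IsUniformArray μ N U) (hN : M ≤ N)
    {P Q : Pattern M k} (hP : P.overlapTwo P = 0) (hQ : Q.overlapTwo Q = 0) (n : ℕ) :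
    μ.real (avoidsBefore U (fun _ : Unit => P) n) = μ.real (avoidsBefore U (fun _ : Unit => Q) n) ∧
    μ.real (avoidsBefore U (fun _ : Unit => P) n ∩ occursAt U P n) =
      μ.real (avoidsBefore U (fun _ : Unit => Q) n ∩ occursAt U Q n) := by
  have hns : ∀ Q : Pattern M k, NeverSimultaneous μ U (fun _ : Unit => Q) :=
    fun Q i j hij => absurd (Subsingleton.elim i j) hij
  induction n with
  | zero =>
    refine ⟨?_, ?_⟩
    · congr 1
      ext ω
      simp [avoidsBefore]
    · rw [hU.measureReal_occursAt_zero hN, hU.measureReal_occursAt_zero hN]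
  | succ n ih =>
    have hP1 := hU.measureReal_avoidsBefore_eq (hns P) n
    have hQ1 := hU.measureReal_avoidsBefore_eq (hns Q) n
    have hP2 := hU.measureReal_avoidsBefore_mul hN (hns P) n ()
    have hQ2 := hU.measureReal_avoidsBefore_mul hN (hns Q) n ()
    simp only [Finset.univ_unique, Finset.sum_const, Finset.card_singleton, one_smul, hP, hQ,
      Nat.cast_zero, zero_mul, add_zero] at hP1 hQ1 hP2 hQ2
    refine ⟨by linarith [ih.1, ih.2], ?_⟩
    rw [← hP2, ← hQ2, ih.1]

/-- Patterns without self-overlap have identically distributed hitting times. -/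
theorem IsUniformArray.identDistrib_hitTime (hU : IsUniformArray μ N U) (hN : M ≤ N)
    {P Q : Pattern M k} (hP : P.overlapTwo P = 0) (hQ : Q.overlapTwo Q = 0) :
    IdentDistrib (hitTime U P) (hitTime U Q) μ μ := by
  have hmP := hU.measurable_hitTime P
  have hmQ := hU.measurable_hitTime Q
  refine ⟨hmP.aemeasurable, hmQ.aemeasurable, ?_⟩
  have hnat : ∀ n : ℕ, (μ.map (hitTime U P)) {(n : ℕ∞)} = (μ.map (hitTime U Q)) {(n : ℕ∞)} := by
    intro n
    have key : ∀ Q : Pattern M k, hitTime U Q ⁻¹' {(n : ℕ∞)} =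
        avoidsBefore U (fun _ : Unit => Q) n ∩ occursAt U Q n :=
      fun Q => Set.ext fun ω => hitTime_eq_natCast
    rw [Measure.map_apply hmP (measurableSet_singleton _),
      Measure.map_apply hmQ (measurableSet_singleton _), key, key]
    exact (measureReal_eq_measureReal_iff).1 (hU.measureReal_avoidsBefore_congr hN hP hQ n).2
  have : IsProbabilityMeasure (μ.map (hitTime U P)) :=
    Measure.isProbabilityMeasure_map hmP.aemeasurable
  have : IsProbabilityMeasure (μ.map (hitTime U Q)) :=
    Measure.isProbabilityMeasure_map hmQ.aemeasurable
  refine Measure.ext_of_singleton fun x => ?_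
  induction x using ENat.recTopCoe with
  | coe n => exact hnat n
  | top =>
    -- The mass at `⊤` is what the finite values leave over.
    have hcompl : ({⊤} : Set ℕ∞) = (⋃ n : ℕ, {(n : ℕ∞)})ᶜ := by
      ext x
      induction x using ENat.recTopCoe <;> simp
    have hd : Pairwise (Function.onFun Disjoint fun n : ℕ => ({(n : ℕ∞)} : Set ℕ∞)) :=
      fun m n hmn => by simpa using hmn
    rw [hcompl, prob_compl_eq_one_sub (.of_discrete), prob_compl_eq_one_sub (.of_discrete),
      measure_iUnion hd fun _ => .of_discrete, measure_iUnion hd fun _ => .of_discrete]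
    simp_rw [hnat]

end Recurrence

/-! ### Summing the recurrence and bounding the weights. -/

section Series

open Filter Topology

variable {ι : Type*} [Fintype ι] {O : ι → ι → ℝ} {e : ℝ}

/-- Summing the recurrence between survival probabilities `t n` and first-occurrence probabilities
`b n i`. -/
theorem sum_recurrence [Nonempty ι] {t : ℕ → ℝ} {b : ℕ → ι → ℝ} {q : ℝ} (hq : 0 < q)
    (ht0 : t 0 = 1) (ht : ∀ n, 0 ≤ t n) (hb : ∀ n i, 0 ≤ b n i) (hb0 : ∀ i, b 0 i = q)
    (hbal : ∀ n, t n = t (n + 1) + ∑ j, b n j)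
    (hrec : ∀ n i, t n * q = b (n + 1) i + ∑ j, O j i * (e * b n j)) :
    Tendsto t atTop (𝓝 0) ∧ (∀ i, Summable fun n => b n i) ∧ ∑ i, ∑' n, b n i = 1 ∧
      ∃ c > 0, ∀ i, ∑' n, b n i + e * ∑ j, O j i * ∑' n, b n j = c := by
  have hpart : ∀ n, ∑ m ∈ Finset.range n, ∑ j, b m j = 1 - t n := by
    intro n
    induction n with
    | zero => simp [ht0]
    | succ n ih => rw [Finset.sum_range_succ, ih, hbal n]; ring
  have hsb : ∀ i, Summable fun n => b n i := by
    intro i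
    refine summable_of_sum_range_le (c := 1) (fun n => hb n i) fun n => ?_
    calc ∑ m ∈ Finset.range n, b m i ≤ ∑ m ∈ Finset.range n, ∑ j, b m j :=
          Finset.sum_le_sum fun m _ =>
            Finset.single_le_sum (f := b m) (fun j _ => hb m j) (Finset.mem_univ i)
      _ ≤ 1 := by rw [hpart]; linarith [ht n]
  have hsr : ∀ i, HasSum (fun n => ∑ j, O j i * (e * b n j))
      (∑ j, O j i * (e * ∑' n, b n j)) := fun i =>
    hasSum_sum fun j _ => ((hsb j).hasSum.mul_left e).mul_left (O j i)
  have hsq : ∀ i, HasSum (fun n => t n * q)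
      (∑' n, b (n + 1) i + ∑ j, O j i * (e * ∑' n, b n j)) := by
    intro i
    simp_rw [hrec _ i]
    exact (((summable_nat_add_iff 1).2 (hsb i)).hasSum).add (hsr i)
  have i₀ : ι := Classical.arbitrary ι
  -- The recurrence writes `t n * q` through summable terms, so `t` is summable; hence some pattern
  -- eventually occurs almost surely.
  have hst : Summable t := (summable_mul_right_iff hq.ne').1 (hsq i₀).summable
  have htend : Tendsto t atTop (𝓝 0) := hst.tendsto_atTop_zero
  refine ⟨htend, hsb, ?_, q + (∑' n, t n) * q, ?_, fun i => ?_⟩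
  · have h1 : HasSum (fun n => ∑ j, b n j) (∑ i, ∑' n, b n i) :=
      hasSum_sum fun j _ => (hsb j).hasSum
    refine tendsto_nhds_unique h1.tendsto_sum_nat ?_
    simp_rw [hpart]
    simpa using htend.const_sub 1
  · have : 0 ≤ ∑' n, t n := tsum_nonneg ht
    positivity
  · rw [(hsb i).tsum_eq_zero_add, hb0, ← tsum_mul_right, (hsq i).tsum_eq, Finset.mul_sum, add_assoc]
    congr 2
    exact Finset.sum_congr rfl fun j _ => by ring

/-- Normalizing a solution of `p + e Oᵀ p = c` gives weights close to `1 - e Oᵀ 1`. -/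
theorem weight_bounds {p : ι → ℝ} {c : ℝ} (hc : 0 < c) (he : 0 ≤ e) (hp : ∀ i, 0 ≤ p i)
    (hO0 : ∀ i j, 0 ≤ O i j) (hO1 : ∀ i j, O i j ≤ 1) (hOd : ∀ i, O i i = 0)
    (h : ∀ i, p i + e * ∑ j, O j i * p j = c) (i : ι) :
    1 - e * ∑ j, O j i ≤ p i / c ∧
      p i / c ≤ 1 - e * (1 - ((Fintype.card ι : ℝ) - 1) * e) * ∑ j, O j i := by
  classical
  have hv : ∀ i, p i / c = 1 - e * ∑ j, O j i * (p j / c) := by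
    intro i
    have : ∑ j, O j i * (p j / c) = (∑ j, O j i * p j) / c := by
      rw [Finset.sum_div]
      exact Finset.sum_congr rfl fun j _ => by ring
    rw [this]
    field_simp
    linarith [h i]
  have hv0 : ∀ i, 0 ≤ p i / c := fun i => div_nonneg (hp i) hc.le
  have hv1 : ∀ i, p i / c ≤ 1 := by
    intro i
    have := mul_nonneg he (Finset.sum_nonneg fun j (_ : j ∈ Finset.univ) =>
      mul_nonneg (hO0 j i) (hv0 j))
    linarith [hv i]
  -- The zero diagonal saves one term, whence `ℓ - 1` in the upper bound.
  have hsum : ∀ i, ∑ j, O j i ≤ (Fintype.card ι : ℝ) - 1 := by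
    intro i
    rw [← Finset.add_sum_erase _ _ (Finset.mem_univ i), hOd, zero_add]
    calc ∑ j ∈ Finset.univ.erase i, O j i ≤ ∑ j ∈ Finset.univ.erase i, (1 : ℝ) :=
          Finset.sum_le_sum fun j _ => hO1 j i
      _ = (Fintype.card ι : ℝ) - 1 := by
          rw [Finset.sum_const, nsmul_one, Finset.cast_card_erase_of_mem (Finset.mem_univ i)]
          rfl
  have hlow : ∀ i, 1 - e * ∑ j, O j i ≤ p i / c := by
    intro i
    rw [hv i]
    gcongr with j
    exact mul_le_of_le_one_right (hO0 j i) (hv1 j)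
  refine ⟨hlow i, ?_⟩
  have hle : (1 - ((Fintype.card ι : ℝ) - 1) * e) * ∑ j, O j i ≤ ∑ j, O j i * (p j / c) := by
    rw [mul_comm, Finset.sum_mul]
    refine Finset.sum_le_sum fun j _ => mul_le_mul_of_nonneg_left ((hlow j).trans' ?_) (hO0 j i)
    linarith [mul_le_mul_of_nonneg_left (hsum j) he]
  rw [hv i, mul_assoc]
  linarith [mul_le_mul_of_nonneg_left hle he]

end Series

/-! ### The winning probability as a series. -/

section FirstPattern

open Filter Topology

variable {Ω : Type*} {N M k : ℕ} [MeasurableSpace Ω] {μ : Measure Ω} [IsProbabilityMeasure μ]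
  {U : ℕ → Fin k → Ω → ℕ} {ι : Type*} {R : ι → Pattern M k}

/-- The two events differ only where no pattern ever occurs and all hitting times are `⊤`; `ht`
makes this null. -/
theorem IsUniformArray.measureReal_iInter_hitTime_le (hU : IsUniformArray μ N U)
    (ht : Tendsto (fun n => μ.real (avoidsBefore U R n)) atTop (𝓝 0)) (i : ι) :
    μ.real (⋂ j, {ω | hitTime U (R i) ω ≤ hitTime U (R j) ω}) =
      ∑' n, μ.real (avoidsBefore U R n ∩ occursAt U (R i) n) := by
  have hnull : μ (⋂ n, avoidsBefore U R n) = 0 := by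
    rw [← measureReal_eq_zero_iff]
    refine le_antisymm (ge_of_tendsto' ht fun n => ?_) measureReal_nonneg
    exact measureReal_mono (Set.iInter_subset _ n)
  have hae : (⋂ j, {ω | hitTime U (R i) ω ≤ hitTime U (R j) ω} : Set Ω) =ᵐ[μ]
      ⋃ n, avoidsBefore U R n ∩ occursAt U (R i) n := by
    refine eventuallyEq_set.2 ?_
    filter_upwards [measure_eq_zero_iff_ae_notMem.1 hnull] with ω hω
    refine ⟨fun h => ?_, fun h => ?_⟩
    · have h' : ∀ j, hitTime U (R i) ω ≤ hitTime U (R j) ω := by simpa using h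
      have havoid : ∀ n : ℕ, (n : ℕ∞) ≤ hitTime U (R i) ω → ω ∈ avoidsBefore U R n :=
        fun n hn m hm j => notMem_occursAt_of_lt
          ((Nat.cast_lt.2 hm).trans_le (hn.trans (h' j)))
      cases hT : hitTime U (R i) ω with
      | top => exact absurd (Set.mem_iInter.2 fun n => havoid n (hT ▸ le_top)) hω
      | coe n => exact Set.mem_iUnion.2 ⟨n, havoid n hT.ge, mem_occursAt_of_hitTime_eq hT⟩
    · obtain ⟨n, hn, hocc⟩ := Set.mem_iUnion.1 h
      exact Set.mem_iInter.2 fun j =>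
        (hitTime_le hocc).trans (le_hitTime fun m hm => hn m hm j)
  have hd : Pairwise (Function.onFun Disjoint fun n =>
      avoidsBefore U R n ∩ occursAt U (R i) n) := by
    intro m n hmn
    refine Set.disjoint_left.2 fun ω hm hn => ?_
    rcases hmn.lt_or_gt with h | h
    · exact hn.1 m h i hm.2
    · exact hm.1 n h i hn.2
  rw [measureReal_congr hae, measureReal_def, measure_iUnion hd fun n =>
    (hU.measurableSet_avoidsBefore R n).inter (hU.measurableSet_occursAt (R i) n),
    ENNReal.tsum_toReal_eq fun n => measure_ne_top _ _]
  rfl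

end FirstPattern

theorem Pattern.overlapTwo_le_one {M k : ℕ} (P Q : Pattern M k) : P.overlapTwo Q ≤ 1 := by
  unfold Pattern.overlapTwo
  split_ifs <;> simp

theorem lemma3p4 {Ω : Type*} [MeasurableSpace Ω] (μ : Measure Ω) [IsProbabilityMeasure μ]
    (N M k ℓ : ℕ) (hM : 2 ≤ M) (hN : M ≤ N) (hk : 2 ≤ k) (hℓ : 2 ≤ ℓ)
    (U : ℕ → Fin k → Ω → ℕ)
    (hU_meas : ∀ m i, Measurable (U m i))
    (hU_unif : ∀ m i, μ.map (U m i) = uniformOn (Set.Icc 1 N))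
    (hU_indep : iIndepFun (fun p : ℕ × Fin k => U p.1 p.2) μ)
    (R : Fin ℓ → Pattern M k)
    (hnotie : ∀ i j, i ≠ j → μ {ω | hitTime U (R i) ω = hitTime U (R j) ω} = 0)
    (hself : ∀ i, (R i).overlapTwo (R i) = 0) :
    (∀ i j, IdentDistrib (hitTime U (R i)) (hitTime U (R j)) μ μ) ∧
    ∃ v : Fin ℓ → ℝ,
      (∀ i, 0 < v i) ∧
      (∀ i, μ.real (⋂ j, {ω | hitTime U (R i) ω ≤ hitTime U (R j) ω}) = v i / ∑ j, v j) ∧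
      ∀ i,
        1 - 1 / (N : ℝ) ^ k * ∑ j, ((R j).overlapTwo (R i) : ℝ) ≤ v i ∧
        v i ≤ 1 - 1 / (N : ℝ) ^ k * (1 - ((ℓ : ℝ) - 1) / (N : ℝ) ^ k) *
          ∑ j, ((R j).overlapTwo (R i) : ℝ) := by
  have hU : IsUniformArray μ N U := ⟨hU_meas, hU_unif, hU_indep⟩
  refine ⟨fun i j => hU.identDistrib_hitTime hN (hself i) (hself j), ?_⟩
  have hns : NeverSimultaneous μ U R := hU.neverSimultaneous hnotie
  have hN0 : (0 : ℝ) < N := by exact_mod_cast (by omega : 0 < N)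
  have : Nonempty (Fin ℓ) := ⟨⟨0, by omega⟩⟩
  obtain ⟨ht, hsb, hsum, c, hc, heq⟩ := sum_recurrence
    (t := fun n => μ.real (avoidsBefore U R n))
    (b := fun n i => μ.real (avoidsBefore U R n ∩ occursAt U (R i) n))
    (O := fun i j => ((R i).overlapTwo (R j) : ℝ)) (e := (1 / (N : ℝ)) ^ k)
    (q := (1 / (N : ℝ)) ^ (k + 1)) (by positivity)
    (by simp [avoidsBefore]) (fun n => measureReal_nonneg) (fun n i => measureReal_nonneg)
    (fun i => hU.measureReal_occursAt_zero hN (R i)) (hU.measureReal_avoidsBefore_eq hns)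
    (hU.measureReal_avoidsBefore_mul hN hns)
  -- The term at time `0` is already `N⁻⁽ᵏ⁺¹⁾ > 0`.
  have hpos : ∀ i, 0 < ∑' n, μ.real (avoidsBefore U R n ∩ occursAt U (R i) n) := fun i =>
    (hsb i).tsum_pos (fun n => measureReal_nonneg) 0
      (by rw [hU.measureReal_occursAt_zero hN]; positivity)
  refine ⟨fun i => (∑' n, μ.real (avoidsBefore U R n ∩ occursAt U (R i) n)) / c,
    fun i => div_pos (hpos i) hc, fun i => ?_, fun i => ?_⟩
  · rw [hU.measureReal_iInter_hitTime_le ht, ← Finset.sum_div, hsum]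
    field_simp
  · have h := weight_bounds hc (by positivity) (fun i => (hpos i).le)
      (fun i j => Nat.cast_nonneg _)
      (fun i j => by exact_mod_cast (R i).overlapTwo_le_one (R j))
      (fun i => by exact_mod_cast hself i) heq i
    rw [Fintype.card_fin, one_div_pow] at h
    rwa [div_eq_mul_one_div ((ℓ : ℝ) - 1)]
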